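/- **Definitions.** For a set $X$, let $X^*$ be the set of countable families $\{x_i\}_{i\in I}$ of elements of $X$ (index sets taken inside a fixed infinite set), where two families $\{x_i\}_I$ and $\{y_j\}_J$ are identified if there is a bijection $\phi\colon I\to J$ with $x_i=y_{\phi(i)}$ for all $i$. For a partial function $\Sigma\colon X^*\rightharpoonup X$, a family $\mathbf x\in X^*$ is *summable* if $\Sigma\mathbf x$ is defined; $\Sigma\mathbf x\simeq x$ means that $\Sigma\mathbf x$ is defined and equal to $x$. The pair $(X,\Sigma)$ is a *weak $\Sigma$-monoid* if: - (singleton) $\Sigma\{x\}\simeq x$ for all $x\in X$; - (neutral element) there is $0\in X$ with $\Sigma\emptyset\simeq 0$ and such that, whenever $\mathbf x\in X^*$ is summable, its subfamily of elements other than $0$ is summable; - (bracketing) for every countable $J$, all *finite* summable families $\mathbf x_j$ $(j\in J)$ and $x \in X$: $\Sigma\big(\biguplus_J\mathbf x_j\big)\simeq x$ implies $\Sigma\{\Sigma\mathbf x_j\}_J\simeq x$; - (flattening) for every *finite* $J$, all summable families $\mathbf x_j$ $(j\in J)$ and $x \in X$: $\Sigma\{\Sigma\mathbf x_j\}_J\simeq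 x$ implies $\Sigma\big(\biguplus_J\mathbf x_j\big)\simeq x$. A *$\Sigma$-homomorphism* $(X,\Sigma)\to(Y,\Sigma')$ is a function $f\colon X\to Y$ such that $\Sigma\{x_i\}_I\simeq x$ implies $\Sigma'\{f(x_i)\}_I\simeq f(x)$. A weak $\Sigma$-monoid is - *strong* if every subfamily of a summable family is summable, and both bracketing and flattening hold for arbitrary countable $J$ and arbitrary summable families $\mathbf x_j$; - *finitely total* if every finite family is summable; - a *$\Sigma$-group* if it is finitely total and there is a $\Sigma$-homomorphism $x\mapsto -x$ from $X$ to itself with $\Sigma\{x,-x\}\simeq 0$ for all $x\in X$. Let $\mathbf{SCat}_w$ be the category of weak $\Sigma$-monoids and $\Sigma$-homomorphisms, and let $\mathbf{SCat}_s$, $\mathbf{SCat}_{ft}$, $\mathbf{SCat}_g$ be its full subcategories of strong $\Sigma$-monoids, finitely total $\Sigma$-monoids, and $\Sigma$-groups, respectively. **Proposition.** Each of the categories $\mathbf{SCat}_w$, $\mathbf{SCat}_s$, $\mathbf{SCat}_{ft}$ and $\mathbf{SCat}_g$ is locally $\aleph_1$-presentable. Consequently, each of them is complete and cocomplete (it has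 all small limits and all small colimits). -/

import Mathlib

open CategoryTheory CategoryTheory.Limits

universe u v w

namespace SigmaMonoids

/-- Concrete families in `X`: an index set `I ⊆ ℕ` together with a function `I → X`. -/
abbrev PreFamily (X : Type u) : Type u := Σ I : Set ℕ, (I → X)

/-- Two indexed families are the same if they differ by a bijection of the index sets. -/
instance PreFamily.setoid (X : Type u) : Setoid (PreFamily X) where
  r x y := ∃ e : x.1 ≃ y.1, ∀ i, x.2 i = y.2 (e i)
  iseqv :=
    { refl := fun _ => ⟨Equiv.refl _, fun _ => rfl⟩
      symm := fun ⟨e, h⟩ => ⟨e.symm, fun i => by rw [h, Equiv.apply_symm_apply]⟩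
      trans := fun ⟨e, h⟩ ⟨e', h'⟩ => ⟨e.trans e', fun i => by rw [h, h']; rfl⟩ }

/-- The set `X^*` of (countable) families of elements of `X`, up to reindexing.
The fixed infinite set in which the index sets live is `ℕ`; by `Family.of` below, every family
indexed by a countable type determines an element of `X^*`. -/
def Family (X : Type u) : Type u := Quotient (PreFamily.setoid X)

namespace Family

/-- The family `{x_i}_{i ∈ ι}` indexed by an arbitrary countable type `ι`
(independent of the chosen injection `ι → ℕ`, see `Family.of_eq_of_iff`). -/
noncomputable def of {X : Type u} {ι : Type v} [Countable ι] (x : ι → X) : Family X :=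
  Quotient.mk (PreFamily.setoid X)
    ⟨Set.range (Classical.choose (exists_injective_nat ι)),
      fun n => x ((Equiv.ofInjective _ (Classical.choose_spec (exists_injective_nat ι))).symm n)⟩

theorem of_eq_of_iff {X : Type u} {ι : Type v} {κ : Type w} [Countable ι] [Countable κ]
    (x : ι → X) (y : κ → X) : of x = of y ↔ ∃ e : ι ≃ κ, ∀ i, x i = y (e i) := by
  refine Iff.trans (Quotient.eq (r := PreFamily.setoid X)) ?_
  let a := Equiv.ofInjective _ (Classical.choose_spec (exists_injective_nat ι))
  let b := Equiv.ofInjective _ (Classical.choose_spec (exists_injective_nat κ))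
  constructor
  · rintro ⟨e, h⟩
    refine ⟨(a.trans e).trans b.symm, fun i => ?_⟩
    have := h (a i)
    simpa [a, b] using this
  · rintro ⟨e, h⟩
    refine ⟨(a.symm.trans e).trans b, fun i => ?_⟩
    have := h (a.symm i)
    simpa [a, b] using this

theorem exists_eq_of {X : Type u} (F : Family X) :
    ∃ (I : Set ℕ) (x : I → X), F = of x := by
  obtain ⟨⟨I, x⟩, rfl⟩ := Quotient.exists_rep F
  refine ⟨I, x, Quotient.sound
    ⟨Equiv.ofInjective _ (Classical.choose_spec (exists_injective_nat I)), fun i => ?_⟩⟩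
  simp

/-- The family `f x = {f (x_i)}_I` in `Y^*` for `x = {x_i}_I` in `X^*`. -/
def map {X : Type u} {Y : Type v} (f : X → Y) : Family X → Family Y :=
  Quotient.lift (fun x => Quotient.mk (PreFamily.setoid Y) ⟨x.1, fun i => f (x.2 i)⟩)
    (fun _ _ ⟨e, h⟩ => Quotient.sound ⟨e, fun i => congrArg f (h i)⟩)

theorem map_of {X : Type u} {Y : Type v} {ι : Type w} [Countable ι] (f : X → Y) (x : ι → X) :
    map f (of x) = of (fun i => f (x i)) := rfl

theorem map_id {X : Type u} (F : Family X) : map id F = F := by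
  obtain ⟨I, x, rfl⟩ := exists_eq_of F
  rfl

theorem map_map {X : Type*} {Y : Type*} {Z : Type*} (g : Y → Z) (f : X → Y) (F : Family X) :
    map g (map f F) = map (g ∘ f) F := by
  obtain ⟨I, x, rfl⟩ := exists_eq_of F
  rfl

end Family

/-- The axioms of a weak `Σ`-monoid for a partial function `S : X^* ⇀ X`.
Here `a ∈ S F` says that `S F` is defined and equal to `a`, and `(S F).Dom` says that the family
`F` is summable. The disjoint union of families `x j : I j → X`, `j ∈ J`, is the family indexed by
the disjoint union `Σ j, I j`. -/
structure IsWeak {X : Type u} (S : Family X →. X) : Prop where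
  singleton : ∀ x : X, x ∈ S (Family.of (fun _ : Unit => x))
  neutral : ∃ z : X, z ∈ S (Family.of (fun i : Empty => i.elim)) ∧
    ∀ {ι : Type} [Countable ι] (x : ι → X), (S (Family.of x)).Dom →
      (S (Family.of (fun i : {i : ι // x i ≠ z} => x i))).Dom
  bracketing : ∀ {J : Type} [Countable J] {I : J → Type} [∀ j, Finite (I j)]
    (x : ∀ j, I j → X) (y : J → X), (∀ j, y j ∈ S (Family.of (x j))) →
    ∀ a : X, a ∈ S (Family.of (fun p : Σ j, I j => x p.1 p.2)) → a ∈ S (Family.of y)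
  flattening : ∀ {J : Type} [Finite J] {I : J → Type} [∀ j, Countable (I j)]
    (x : ∀ j, I j → X) (y : J → X), (∀ j, y j ∈ S (Family.of (x j))) →
    ∀ a : X, a ∈ S (Family.of y) → a ∈ S (Family.of (fun p : Σ j, I j => x p.1 p.2))

/-- `f` is a `Σ`-homomorphism: if `Σ F` is defined and equal to `a`,
then `Σ' (f F)` is defined and equal to `f a`. -/
def IsSigmaHom {X : Type u} {Y : Type v} (S : Family X →. X) (S' : Family Y →. Y)
    (f : X → Y) : Prop :=
  ∀ (F : Family X) (a : X), a ∈ S F → f a ∈ S' (F.map f)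

/-- The additional axioms that make a weak `Σ`-monoid a strong `Σ`-monoid. -/
structure IsStrong {X : Type u} (S : Family X →. X) : Prop where
  subsummability : ∀ {ι κ : Type} [Countable ι] [Countable κ] (x : ι → X) (φ : κ → ι),
    Function.Injective φ → (S (Family.of x)).Dom → (S (Family.of (fun k => x (φ k)))).Dom
  strong_bracketing : ∀ {J : Type} [Countable J] {I : J → Type} [∀ j, Countable (I j)]
    (x : ∀ j, I j → X) (y : J → X), (∀ j, y j ∈ S (Family.of (x j))) →
    ∀ a : X, a ∈ S (Family.of (fun p : Σ j, I j => x p.1 p.2)) → a ∈ S (Family.of y)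
  strong_flattening : ∀ {J : Type} [Countable J] {I : J → Type} [∀ j, Countable (I j)]
    (x : ∀ j, I j → X) (y : J → X), (∀ j, y j ∈ S (Family.of (x j))) →
    ∀ a : X, a ∈ S (Family.of y) → a ∈ S (Family.of (fun p : Σ j, I j => x p.1 p.2))

/-- Every finite family is summable. -/
def IsFinitelyTotal {X : Type u} (S : Family X →. X) : Prop :=
  ∀ {ι : Type} [Finite ι] (x : ι → X), (S (Family.of x)).Dom

/-- There is an inversion map which is a `Σ`-homomorphism: `Σ {x, -x}` is defined and equal to
`0 = Σ ∅`. -/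
def HasSigmaInverses {X : Type u} (S : Family X →. X) : Prop :=
  ∃ neg : X → X,
    (∀ x : X, ∃ z : X, z ∈ S (Family.of (fun i : Empty => i.elim)) ∧
      z ∈ S (Family.of ![x, neg x])) ∧
    IsSigmaHom S S neg

/-- Weak `Σ`-monoids with underlying set in `Type u`. -/
structure WeakSigmaMon : Type (u + 1) where
  carrier : Type u
  sum : Family carrier →. carrier
  isWeak : IsWeak sum

namespace WeakSigmaMon

/-- Morphisms of weak `Σ`-monoids are the `Σ`-homomorphisms. -/
@[ext]
structure Hom (X Y : WeakSigmaMon.{u}) : Type u where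
  toFun : X.carrier → Y.carrier
  isSigmaHom : IsSigmaHom X.sum Y.sum toFun

/-- The category of weak `Σ`-monoids and `Σ`-homomorphisms. -/
instance category : Category.{u} WeakSigmaMon.{u} where
  Hom X Y := Hom X Y
  id X := ⟨id, fun F a h => by rw [Family.map_id]; exact h⟩
  comp f g := ⟨g.toFun ∘ f.toFun, fun F a h => by
    rw [← Family.map_map]; exact g.isSigmaHom _ _ (f.isSigmaHom _ _ h)⟩

/-- Strong `Σ`-monoids among weak `Σ`-monoids. -/
def strong : ObjectProperty WeakSigmaMon.{u} := fun X => IsStrong X.sum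

/-- Finitely total `Σ`-monoids among weak `Σ`-monoids. -/
def finitelyTotal : ObjectProperty WeakSigmaMon.{u} := fun X => IsFinitelyTotal X.sum

/-- `Σ`-groups among weak `Σ`-monoids. -/
def group : ObjectProperty WeakSigmaMon.{u} :=
  fun X => IsFinitelyTotal X.sum ∧ HasSigmaInverses X.sum

end WeakSigmaMon

/-- The full subcategory of strong `Σ`-monoids. -/
abbrev StrongSigmaMon : Type (u + 1) := WeakSigmaMon.strong.{u}.FullSubcategory

/-- The full subcategory of finitely total `Σ`-monoids. -/
abbrev FinTotalSigmaMon : Type (u + 1) := WeakSigmaMon.finitelyTotal.{u}.FullSubcategory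

/-- The full subcategory of `Σ`-groups. -/
abbrev SigmaGrp : Type (u + 1) := WeakSigmaMon.group.{u}.FullSubcategory

instance fact_isRegular_aleph_one : Fact (Cardinal.aleph.{u} 1).IsRegular :=
  ⟨Cardinal.isRegular_aleph_one⟩

end SigmaMonoids

/-! A partial sum is a relation between families and elements, so weak Σ-monoids embed fully and
faithfully (`ofWeak`) into the category `SigmaRel` of sets with such a relation. `SigmaRel` is
locally ℵ₁-presentable: structures presented by countably many variables and atomic formulas are
ℵ₁-presentable and form a small strong generator.

Orthogonality to a map of countable presentations is a sentence "for all v satisfying Φ there is a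
unique extension w satisfying Ψ". For each of the four categories, take all such maps orthogonal to
every object of the category. The objects local for this small set form a reflective, locally
ℵ₁-presentable subcategory, so it remains to show that local objects lie in the image
(`locallyPresentable_of_isLocal_le`). By `existsUnique_of_isLocal` they inherit every such sentence
valid in the category, so each axiom has to be put in this form. Two resist: the neutral element
axiom mentions x ≠ 0, and inversion is a function outside the signature. `IsWeak.mem_comp` gives a
negation-free form of the former; `IsWeak.eq_of_mem_pair` makes inverses unique, hence definable. -/

namespace SigmaMonoids

attribute [simp] Family.map_of

/-- The action of a function on pairs consisting of a family and an element. -/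
def pairMap {X : Type u} {Y : Type v} (f : X → Y) (p : Family X × X) : Family Y × Y :=
  (p.1.map f, f p.2)

@[simp]
theorem pairMap_mk {X : Type u} {Y : Type v} (f : X → Y) (F : Family X) (a : X) :
    pairMap f (F, a) = (F.map f, f a) := rfl

@[simp]
theorem pairMap_id {X : Type u} (p : Family X × X) : pairMap id p = p := by
  simp [pairMap, Family.map_id]

theorem pairMap_pairMap {X Y Z : Type*} (g : Y → Z) (f : X → Y) (p : Family X × X) :
    pairMap g (pairMap f p) = pairMap (g ∘ f) p := by
  simp [pairMap, Family.map_map]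

/-! ### Relational structures. -/

/-- Sets equipped with a relation between families and elements. -/
structure SigmaRel : Type (u + 1) where
  carrier : Type u
  rel : Set (Family carrier × carrier)

namespace SigmaRel

/-- Relation preserving functions. -/
@[ext]
structure Hom (X Y : SigmaRel.{u}) : Type u where
  toFun : X.carrier → Y.carrier
  map_rel : ∀ p ∈ X.rel, pairMap toFun p ∈ Y.rel

instance category : Category.{u} SigmaRel.{u} where
  Hom X Y := Hom X Y
  id X := ⟨id, fun p h => by rwa [pairMap_id]⟩
  comp f g := ⟨g.toFun ∘ f.toFun, fun p h => by
    rw [← pairMap_pairMap]; exact g.map_rel _ (f.map_rel _ h)⟩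

@[ext]
theorem hom_ext {X Y : SigmaRel.{u}} {f g : X ⟶ Y} (h : ∀ x, f.toFun x = g.toFun x) : f = g :=
  Hom.ext (funext h)

/-- The underlying set functor. -/
def forgetToType : SigmaRel.{u} ⥤ Type u where
  obj X := X.carrier
  map f := ↾f.toFun

/-! ### Limits and colimits of relational structures, computed on underlying sets. -/

section Limits

variable {J : Type v} [Category.{w} J] (F : J ⥤ SigmaRel.{u})

/-- The projections of a cone of sets, as functions. -/
def coneProj (c : Cone (F ⋙ forgetToType)) (j : J) : c.pt → (F.obj j).carrier :=
  fun x => c.π.app j x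

/-- The coprojections of a cocone of sets, as functions. -/
def coconeIncl (c : Cocone (F ⋙ forgetToType)) (j : J) : (F.obj j).carrier → c.pt :=
  fun x => c.ι.app j x

/-- The cone of relational structures on a cone of sets. -/
def liftCone (c : Cone (F ⋙ forgetToType)) : Cone F where
  pt := ⟨c.pt, {p | ∀ j, pairMap (coneProj F c j) p ∈ (F.obj j).rel}⟩
  π :=
    { app j := ⟨coneProj F c j, fun _ hp => hp j⟩
      naturality j k f := by
        ext x
        exact (ConcreteCategory.congr_hom (c.w f) x).symm }

/-- The cone `liftCone F c` is limiting if `c` is. -/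
def isLimitLiftCone {c : Cone (F ⋙ forgetToType)} (hc : IsLimit c) :
    IsLimit (liftCone F c) where
  lift s :=
    let l : s.pt.carrier → c.pt := fun x => hc.lift (forgetToType.mapCone s) x
    ⟨l, fun p hp j => by
      have : coneProj F c j ∘ l = (s.π.app j).toFun :=
        funext fun x => ConcreteCategory.congr_hom (hc.fac (forgetToType.mapCone s) j) x
      have h := (s.π.app j).map_rel p hp
      rwa [← this, ← pairMap_pairMap] at h⟩
  fac s j := by
    ext x
    exact ConcreteCategory.congr_hom (hc.fac (forgetToType.mapCone s) j) x
  uniq s m hm := by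
    have : forgetToType.map m = hc.lift (forgetToType.mapCone s) :=
      hc.uniq (forgetToType.mapCone s) _ fun j => congrArg forgetToType.map (hm j)
    ext x
    exact ConcreteCategory.congr_hom this x

/-- The cocone of relational structures on a cocone of sets. -/
def liftCocone (c : Cocone (F ⋙ forgetToType)) : Cocone F where
  pt := ⟨c.pt, {p | ∃ j, ∃ q ∈ (F.obj j).rel, pairMap (coconeIncl F c j) q = p}⟩
  ι :=
    { app j := ⟨coconeIncl F c j, fun p hp => ⟨j, p, hp, rfl⟩⟩
      naturality j k f := by
        ext x
        exact ConcreteCategory.congr_hom (c.w f) x }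

/-- The cocone `liftCocone F c` is colimiting if `c` is. -/
def isColimitLiftCocone {c : Cocone (F ⋙ forgetToType)} (hc : IsColimit c) :
    IsColimit (liftCocone F c) where
  desc s :=
    let l : c.pt → s.pt.carrier := fun x => hc.desc (forgetToType.mapCocone s) x
    ⟨l, by
      rintro _ ⟨j, q, hq, rfl⟩
      have : l ∘ coconeIncl F c j = (s.ι.app j).toFun :=
        funext fun x => ConcreteCategory.congr_hom (hc.fac (forgetToType.mapCocone s) j) x
      have h := (s.ι.app j).map_rel q hq
      rwa [← this, ← pairMap_pairMap] at h⟩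
  fac s j := by
    ext x
    exact ConcreteCategory.congr_hom (hc.fac (forgetToType.mapCocone s) j) x
  uniq s m hm := by
    have : forgetToType.map m = hc.desc (forgetToType.mapCocone s) :=
      hc.uniq (forgetToType.mapCocone s) _ fun j => congrArg forgetToType.map (hm j)
    ext x
    exact ConcreteCategory.congr_hom this x

end Limits

instance : HasLimitsOfSize.{u, u} SigmaRel.{u} where
  has_limits_of_shape _ _ :=
    ⟨fun F => ⟨⟨_, isLimitLiftCone F (limit.isLimit (F ⋙ forgetToType))⟩⟩⟩

instance : HasColimitsOfSize.{u, u} SigmaRel.{u} where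
  has_colimits_of_shape _ _ :=
    ⟨fun F => ⟨⟨_, isColimitLiftCocone F (colimit.isColimit (F ⋙ forgetToType))⟩⟩⟩

/-! ### Presentability of countable structures. -/

theorem hasCardinalLT_aleph_one (X : Type v) [Countable X] :
    HasCardinalLT X (Cardinal.aleph.{u} 1) := by
  have : Cardinal.lift.{u} (Cardinal.mk X) < Cardinal.lift.{v} (Cardinal.aleph.{u} 1) := by
    rw [Cardinal.lift_aleph, Ordinal.lift_one]
    exact lt_of_le_of_lt (b := Cardinal.aleph0) (by simp) (by simp)
  exact this

/-- A morphism out of `P` consists of countably many values subject to countably many atomic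
conditions, each involving a countable family; in an ℵ₁-filtered colimit all of this is settled at
one stage. -/
theorem isCardinalPresentable_of_countable (P : SigmaRel.{u}) [Countable P.carrier]
    (hP : P.rel.Countable) : IsCardinalPresentable P (Cardinal.aleph.{u} 1) where
  preservesColimitOfShape J _ _ := ⟨fun {F} => by
    have := isFiltered_of_isCardinalFiltered J (Cardinal.aleph.{u} 1)
    have hpres (X : Type u) [Countable X] : IsCardinalPresentable X (Cardinal.aleph.{u} 1) :=
      (hasCardinalLT_aleph_one X).isCardinalPresentable
    have hc := colimit.isColimit (F ⋙ forgetToType)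
    set c := colimit.cocone (F ⋙ forgetToType)
    refine preservesColimit_of_preserves_colimit_cocone (isColimitLiftCocone F hc) ?_
    refine Types.FilteredColimit.isColimitOf' _ _ (fun (f : P ⟶ _) => ?_)
      (fun j (f : P ⟶ _) (g : P ⟶ _) h => ?_)
    · have := hpres P.carrier
      obtain ⟨j, f', hf'⟩ := IsCardinalPresentable.exists_hom_of_isColimit
        (Cardinal.aleph.{u} 1) hc (X := P.carrier) (↾f.toFun)
      have hf (x : P.carrier) : c.ι.app j (f' x) = f.toFun x :=
        ConcreteCategory.congr_hom hf' x
      -- Each atom of `P` holds from some stage on. Its image comes from an atom at a stage `k`,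
      -- with entries matching only in the colimit. The matching equations, indexed by `Option K`
      -- with `none` for the value, are countably many, so they hold together at one stage `l`.
      have key (p : P.rel) : ∃ (k : J) (g : j ⟶ k),
          pairMap (fun x => (F.map g).toFun (f' x)) p.1 ∈ (F.obj k).rel := by
        obtain ⟨⟨p, a⟩, hp⟩ := p
        obtain ⟨k, ⟨q, b⟩, hq, h⟩ := f.map_rel _ hp
        obtain ⟨I, x, rfl⟩ := Family.exists_eq_of p
        obtain ⟨K, y, rfl⟩ := Family.exists_eq_of q
        obtain ⟨e, he⟩ := (Family.of_eq_of_iff (fun i => coconeIncl F c k (y i))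
          (fun i => f.toFun (x i))).1 (congrArg Prod.fst h)
        have hb : coconeIncl F c k b = f.toFun a := congrArg Prod.snd h
        have := hpres (ULift.{u} (Option K))
        let g₁ : ULift.{u} (Option K) ⟶ (F ⋙ forgetToType).obj k :=
          ↾fun o => o.down.elim b y
        let g₂ : ULift.{u} (Option K) ⟶ (F ⋙ forgetToType).obj j :=
          ↾fun o => f' (o.down.elim a (fun i => x (e i)))
        obtain ⟨l, s, t, hst⟩ := IsCardinalPresentable.exists_eq_of_isColimit
          (Cardinal.aleph.{u} 1) hc g₁ g₂ (by
            ext ⟨o⟩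
            cases o with
            | none => exact hb.trans (hf a).symm
            | some i => exact (he i).trans (hf _).symm)
        refine ⟨l, t, ?_⟩
        have h₀ := ConcreteCategory.congr_hom hst ⟨none⟩
        have h₁ (i : K) := ConcreteCategory.congr_hom hst ⟨some i⟩
        have h₂ := (F.map s).map_rel _ hq
        rw [pairMap_mk, Family.map_of] at h₂ ⊢
        rw [show Family.of (fun i => (F.map t).toFun (f' (x i))) =
          Family.of (fun i => (F.map s).toFun (y i)) from
          ((Family.of_eq_of_iff _ _).2 ⟨e, h₁⟩).symm]
        exact (show (F.map s).toFun b = (F.map t).toFun (f' a) from h₀) ▸ h₂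
      choose k g hg using key
      have : Countable P.rel := hP
      -- One stage below which all atoms hold, compatibly with the maps from `j`.
      obtain ⟨m, a, b, hab⟩ := IsCardinalFiltered.wideSpan g (hasCardinalLT_aleph_one P.rel)
      refine ⟨m, ⟨fun x => (F.map b).toFun (f' x), fun p hp => ?_⟩, ?_⟩
      · have := (F.map (a ⟨p, hp⟩)).map_rel _ (hg ⟨p, hp⟩)
        rw [pairMap_pairMap] at this
        convert this using 2
        ext x
        rw [← hab ⟨p, hp⟩, F.map_comp]
        rfl
      · exact SigmaRel.hom_ext fun x =>
          (hf x).symm.trans (ConcreteCategory.congr_hom (c.w b) (f' x)).symm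
    · have := hpres P.carrier
      obtain ⟨k, a, hk⟩ := IsCardinalPresentable.exists_eq_of_isColimit'
        (Cardinal.aleph.{u} 1) hc (X := P.carrier) (i := j) (↾f.toFun) (↾g.toFun)
        (congrArg (fun f : P ⟶ (liftCocone F c).pt => (↾f.toFun : P.carrier ⟶ c.pt)) h)
      exact ⟨k, a, SigmaRel.hom_ext fun x => ConcreteCategory.congr_hom hk x⟩⟩

theorem isIso_of_bijective {X Y : SigmaRel.{u}} (f : X ⟶ Y) (hf : Function.Bijective f.toFun)
    (hrel : ∀ p ∈ Y.rel, ∃ q ∈ X.rel, pairMap f.toFun q = p) : IsIso f := by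
  obtain ⟨g, hgf, hfg⟩ := Function.bijective_iff_has_inverse.1 hf
  refine ⟨⟨g, fun p hp => ?_⟩, hom_ext hgf, hom_ext hfg⟩
  obtain ⟨q, hq, rfl⟩ := hrel p hp
  rwa [pairMap_pairMap, hgf.comp_eq_id, pairMap_id]

/-! ### Countable presentations and the strong generator. -/

/-- The function `v` satisfies the atomic formulas in `Φ`. -/
def Sat {V : Type v} (X : SigmaRel.{u}) (v : V → X.carrier) (Φ : Set (Family V × V)) : Prop :=
  ∀ p ∈ Φ, pairMap v p ∈ X.rel

/-- The relational structure presented by a set of variables and a set of atomic formulas. -/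
def free (V : Type) (Φ : Set (Family V × V)) : SigmaRel.{u} where
  carrier := ULift.{u} V
  rel := pairMap ULift.up '' Φ

/-- Morphisms from a presented relational structure are satisfying assignments. -/
def free.desc {V : Type} {Φ : Set (Family V × V)} {X : SigmaRel.{u}} (v : V → X.carrier)
    (hv : X.Sat v Φ) : free.{u} V Φ ⟶ X where
  toFun x := v x.down
  map_rel := by
    rintro _ ⟨p, hp, rfl⟩
    exact Set.mem_of_eq_of_mem (pairMap_pairMap _ ULift.up p) (hv p hp)

theorem free.sat {V : Type} {Φ : Set (Family V × V)} {X : SigmaRel.{u}} (f : free.{u} V Φ ⟶ X) :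
    X.Sat (fun x => f.toFun ⟨x⟩) Φ := fun p hp =>
  Set.mem_of_eq_of_mem (pairMap_pairMap f.toFun ULift.up p).symm (f.map_rel _ ⟨p, hp, rfl⟩)

theorem isCardinalPresentable_free (V : Type) [Countable V] {Φ : Set (Family V × V)}
    (hΦ : Φ.Countable) : IsCardinalPresentable (free.{u} V Φ) (Cardinal.aleph.{u} 1) :=
  have : Countable (free.{u} V Φ).carrier := inferInstanceAs (Countable (ULift V))
  isCardinalPresentable_of_countable _ (hΦ.image _)

/-- Countable presentations whose variables are natural numbers. -/
abbrev CountablePresentation : Type :=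
  Σ I : Set ℕ, {Φ : Set (Family I × I) // Φ.Countable}

/-- The structure given by a countable presentation. -/
def CountablePresentation.toSigmaRel (d : CountablePresentation) : SigmaRel.{u} :=
  free d.1 d.2

/-- Variables in subsets of ℕ keep the presentations small; this lets later arguments use any
countable type of variables. -/
theorem exists_iso_free (V : Type) [Countable V] {Φ : Set (Family V × V)} (hΦ : Φ.Countable) :
    ∃ d : CountablePresentation, Nonempty (d.toSigmaRel ≅ free.{u} V Φ) := by
  obtain ⟨f, hf⟩ := exists_injective_nat V
  let e := Equiv.ofInjective f hf
  refine ⟨⟨Set.range f, pairMap e '' Φ, hΦ.image _⟩, ⟨?_⟩⟩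
  exact
    { hom := free.desc (fun x => ⟨e.symm x⟩) (by
        rintro _ ⟨p, hp, rfl⟩
        refine ⟨p, hp, Eq.trans ?_ (pairMap_pairMap _ e p).symm⟩
        exact congrArg (pairMap · p) (funext fun x => congrArg ULift.up
          (e.symm_apply_apply x).symm))
      inv := free.desc (fun x => ⟨e x⟩) (fun p hp =>
        ⟨pairMap e p, ⟨p, hp, rfl⟩, pairMap_pairMap _ _ _⟩)
      hom_inv_id := hom_ext fun x => congrArg ULift.up (e.apply_symm_apply x.down)
      inv_hom_id := hom_ext fun x => congrArg ULift.up (e.symm_apply_apply x.down) }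

/-- The property of being one of the structures given by a countable presentation. -/
def isCountablyPresented : ObjectProperty SigmaRel.{u} :=
  ObjectProperty.ofObj CountablePresentation.toSigmaRel.{u}

instance : ObjectProperty.Small.{u} isCountablyPresented.{u} :=
  inferInstanceAs (ObjectProperty.Small.{u}
    (ObjectProperty.ofObj CountablePresentation.toSigmaRel.{u}))

/-- One variable without formulas detects elements; the generic atom on `Option I`, with value
`none`, detects the relation. -/
theorem isStrongGenerator_isCountablyPresented : isCountablyPresented.{u}.IsStrongGenerator := by
  rw [ObjectProperty.isStrongGenerator_iff]
  have sat₀ {V : Type} {X : SigmaRel.{u}} (v : V → X.carrier) : X.Sat v ∅ := fun _ h => h.elim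
  constructor
  · intro X Y f g h
    ext x
    obtain ⟨d, ⟨e⟩⟩ := exists_iso_free.{u} Unit (Φ := ∅) Set.countable_empty
    have := h d.toSigmaRel ⟨d⟩ (e.hom ≫ free.desc (fun _ => x) (sat₀ _))
    rw [Category.assoc, Category.assoc, cancel_epi] at this
    exact congrFun (congrArg Hom.toFun this) ⟨()⟩
  · intro X Y i _ h
    have h' (V : Type) [Countable V] {Φ : Set (Family V × V)} (hΦ : Φ.Countable)
        (v : V → Y.carrier) (hv : Y.Sat v Φ) :
        ∃ w : V → X.carrier, X.Sat w Φ ∧ ∀ x, i.toFun (w x) = v x := by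
      obtain ⟨d, ⟨e⟩⟩ := exists_iso_free.{u} V hΦ
      obtain ⟨g, hg⟩ := h d.toSigmaRel ⟨d⟩ (e.hom ≫ free.desc v hv)
      have hg' : (e.inv ≫ g) ≫ i = free.desc v hv := by
        rw [Category.assoc]
        exact (congrArg (e.inv ≫ ·) hg).trans (by simp)
      exact ⟨_, free.sat (e.inv ≫ g), fun x => congrFun (congrArg Hom.toFun hg') ⟨x⟩⟩
    refine isIso_of_bijective i ⟨fun x y hxy => ?_, fun y => ?_⟩ ?_
    · have : free.desc (V := Unit) (fun _ => x) (sat₀ _) = free.desc (fun _ => y) (sat₀ _) := by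
        rw [← cancel_mono i]
        exact hom_ext fun _ => hxy
      exact congrFun (congrArg Hom.toFun this) ⟨()⟩
    · obtain ⟨w, -, hw⟩ := h' Unit Set.countable_empty (fun _ => y) (sat₀ _)
      exact ⟨_, hw ()⟩
    · rintro ⟨F, a⟩ hp
      obtain ⟨I, y, rfl⟩ := Family.exists_eq_of F
      obtain ⟨w, hw, hwy⟩ := h' (Option I) (Φ := {(Family.of some, none)})
        (Set.countable_singleton _) (fun o => o.elim a y) (by rintro _ rfl; exact hp)
      refine ⟨_, hw _ rfl, ?_⟩
      rw [pairMap_mk, pairMap_mk, Family.map_of, Family.map_of]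
      simp only [hwy]
      rfl

instance : IsCardinalLocallyPresentable SigmaRel.{u} (Cardinal.aleph.{u} 1) := by
  rw [IsCardinalLocallyPresentable.iff_exists_isStrongGenerator]
  refine ⟨isCountablyPresented, inferInstance, isStrongGenerator_isCountablyPresented, ?_⟩
  rintro _ ⟨d⟩
  exact isCardinalPresentable_free d.1 d.2.2

/-! ### Orthogonality classes and transfer of sentences. -/

section

variable {C : Type v} [Category.{w} C] (N : C ⥤ SigmaRel.{u})

/-- The morphisms between countably presented structures which are orthogonal to all objects in
the image of a functor. -/
def orthogonalMorphisms : MorphismProperty SigmaRel.{u} :=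
  MorphismProperty.ofHoms (ι := Σ d d' : CountablePresentation,
    {f : d.toSigmaRel.{u} ⟶ d'.toSigmaRel // N.essImage.isLocal f}) (fun t => t.2.2.1)

instance : MorphismProperty.IsSmall.{u} (orthogonalMorphisms N) :=
  MorphismProperty.isSmall_ofHoms _

variable {N}

theorem bijective_comp_of_isLocal {X : SigmaRel.{u}} (hX : (orthogonalMorphisms N).isLocal X)
    {V V' : Type} [Countable V] [Countable V'] {Φ : Set (Family V × V)}
    {Ψ : Set (Family V' × V')} (hΦ : Φ.Countable) (hΨ : Ψ.Countable)
    (f : free.{u} V Φ ⟶ free V' Ψ) (hf : N.essImage.isLocal f) :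
    Function.Bijective (fun g : free.{u} V' Ψ ⟶ X => f ≫ g) := by
  obtain ⟨d, ⟨e⟩⟩ := exists_iso_free.{u} V hΦ
  obtain ⟨d', ⟨e'⟩⟩ := exists_iso_free.{u} V' hΨ
  have h₁ : N.essImage.isLocal (e.hom ≫ f ≫ e'.inv) := by
    rwa [MorphismProperty.cancel_left_of_respectsIso N.essImage.isLocal,
      MorphismProperty.cancel_right_of_respectsIso N.essImage.isLocal]
  have h₂ : (ObjectProperty.singleton X).isLocal (e.hom ≫ f ≫ e'.inv) := by
    rintro _ ⟨⟩
    exact hX _ (MorphismProperty.ofHoms.mk (ι := Σ d d' : CountablePresentation,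
      {f : d.toSigmaRel.{u} ⟶ d'.toSigmaRel // N.essImage.isLocal f}) ⟨d, d', _, h₁⟩)
  rw [MorphismProperty.cancel_left_of_respectsIso (ObjectProperty.singleton X).isLocal,
    MorphismProperty.cancel_right_of_respectsIso (ObjectProperty.singleton X).isLocal] at h₂
  exact h₂ X (by simp)

/-- Unique existence statements with countably many variables and atomic formulas which hold in
the image of a functor also hold in all local objects. -/
theorem existsUnique_of_isLocal {X : SigmaRel.{u}} (hX : (orthogonalMorphisms N).isLocal X)
    {V V' : Type} [Countable V] [Countable V'] {Φ : Set (Family V × V)} (i : V → V')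
    {Ψ : Set (Family V' × V')} (hΦ : Φ.Countable) (hΨ : Ψ.Countable)
    (h : ∀ (c : C) (v : V → (N.obj c).carrier), (N.obj c).Sat v Φ →
      ∃! w : V' → (N.obj c).carrier, w ∘ i = v ∧ (N.obj c).Sat w Ψ)
    (v : V → X.carrier) (hv : X.Sat v Φ) :
    ∃! w : V' → X.carrier, w ∘ i = v ∧ X.Sat w Ψ := by
  have sat_union {Y : SigmaRel.{u}} {w : V' → Y.carrier} (h₁ : Y.Sat (w ∘ i) Φ)
      (h₂ : Y.Sat w Ψ) : Y.Sat w (pairMap i '' Φ ∪ Ψ) := by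
    rintro _ (⟨p, hp, rfl⟩ | hp)
    · rw [pairMap_pairMap]
      exact h₁ p hp
    · exact h₂ _ hp
  -- Orthogonality to `f` is exactly the unique existence statement. Since `i` need not be
  -- injective, equations between variables can also be conclusions.
  let f : free.{u} V Φ ⟶ free V' (pairMap i '' Φ ∪ Ψ) :=
    free.desc (fun x => ⟨i x⟩) fun p hp => ⟨_, Or.inl ⟨p, hp, rfl⟩, pairMap_pairMap _ _ _⟩
  have key {Y : SigmaRel.{u}} : Function.Bijective
      (fun g : free.{u} V' (pairMap i '' Φ ∪ Ψ) ⟶ Y => f ≫ g) ↔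
      ∀ v : V → Y.carrier, Y.Sat v Φ → ∃! w : V' → Y.carrier, w ∘ i = v ∧ Y.Sat w Ψ := by
    rw [Function.bijective_iff_existsUnique]
    constructor
    · intro H v hv
      obtain ⟨g, hg, hg'⟩ := H (free.desc v hv)
      refine ⟨fun x => g.toFun ⟨x⟩, ⟨?_, fun p hp => free.sat g p (Or.inr hp)⟩, ?_⟩
      · ext x
        exact congrFun (congrArg Hom.toFun hg) ⟨x⟩
      · rintro w ⟨rfl, hw⟩
        have := hg' (free.desc w (sat_union hv hw)) rfl
        rw [← this]
        rfl
    · intro H g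
      obtain ⟨w, ⟨hw, hw'⟩, hu⟩ := H _ (free.sat g)
      refine ⟨free.desc w (sat_union (hw ▸ free.sat g) hw'), ?_, ?_⟩
      · exact hom_ext fun x => congrFun hw x.down
      · rintro k rfl
        have := hu (fun x => k.toFun ⟨x⟩) ⟨rfl, fun p hp => free.sat k p (Or.inr hp)⟩
        subst this
        rfl
  refine key.1 (bijective_comp_of_isLocal hX hΦ ((hΦ.image _).union hΨ) f ?_) v hv
  rw [ObjectProperty.isLocal]
  rintro Z ⟨c, ⟨e⟩⟩
  have : (ObjectProperty.singleton (N.obj c)).isLocal f := by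
    rintro _ ⟨⟩
    exact key.2 (h c)
  rw [← ObjectProperty.isoClosure_isLocal] at this
  exact this Z ⟨_, by simp, ⟨e.symm⟩⟩

/-- Horn clauses with countably many variables and premises which hold in the image of a functor
also hold in all local objects. -/
theorem horn_of_isLocal {X : SigmaRel.{u}} (hX : (orthogonalMorphisms N).isLocal X)
    {V : Type} [Countable V] {Φ : Set (Family V × V)} (p : Family V × V) (hΦ : Φ.Countable)
    (h : ∀ (c : C) (v : V → (N.obj c).carrier), (N.obj c).Sat v Φ →
      pairMap v p ∈ (N.obj c).rel)
    (v : V → X.carrier) (hv : X.Sat v Φ) : pairMap v p ∈ X.rel := by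
  obtain ⟨w, ⟨rfl, hw⟩, -⟩ := existsUnique_of_isLocal hX (id : V → V) (Ψ := {p}) hΦ
    (Set.countable_singleton _) (fun c v hv => ⟨v, ⟨rfl, by rintro _ rfl; exact h c v hv⟩,
      fun w hw => hw.1⟩) v hv
  exact hw _ rfl

variable (N)

/-- Image objects are local by the choice of `orthogonalMorphisms`, so `hN` makes `C` equivalent to
the full subcategory of local objects, which is reflective and locally ℵ₁-presentable. -/
theorem locallyPresentable_of_isLocal_le [N.Full] [N.Faithful]
    (hN : (orthogonalMorphisms N).isLocal ≤ N.essImage) :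
    IsCardinalLocallyPresentable.{u} C (Cardinal.aleph.{u} 1) ∧
      HasLimitsOfSize.{u, u} C ∧ HasColimitsOfSize.{u, u} C := by
  have hW : ∀ ⦃X Y : SigmaRel.{u}⦄ (f : X ⟶ Y), orthogonalMorphisms N f →
      IsCardinalPresentable X (Cardinal.aleph.{u} 1) ∧
        IsCardinalPresentable Y (Cardinal.aleph.{u} 1) := by
    rintro _ _ _ ⟨t⟩
    exact ⟨isCardinalPresentable_free t.1.1 t.1.2.2,
      isCardinalPresentable_free t.2.1.1 t.2.1.2.2⟩
  have hN' (c : C) : (orthogonalMorphisms N).isLocal (N.obj c) := by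
    rintro _ _ _ ⟨t⟩
    exact t.2.2.2 _ (N.obj_mem_essImage c)
  let E : C ⥤ (orthogonalMorphisms N).isLocal.FullSubcategory :=
    ObjectProperty.lift _ N hN'
  have : E.EssSurj := ⟨fun X => by
    obtain ⟨c, ⟨e⟩⟩ := hN _ X.property
    exact ⟨c, ⟨ObjectProperty.isoMk _ e⟩⟩⟩
  have : E.IsEquivalence := { }
  have := MorphismProperty.isRightAdjoint_ι_isLocal _ _ hW
  have hP := MorphismProperty.isLocallyPresentable_isLocal _ _ hW
  have : Reflective (orthogonalMorphisms N).isLocal.ι :=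
    ⟨_, Adjunction.ofIsRightAdjoint _⟩
  have hL : HasLimitsOfSize.{u, u} (orthogonalMorphisms N).isLocal.FullSubcategory :=
    hasLimits_of_reflective (orthogonalMorphisms N).isLocal.ι
  have hC : IsCardinalLocallyPresentable.{u} C (Cardinal.aleph.{u} 1) :=
    E.asEquivalence.symm.isCardinalLocallyPresentable _
  exact ⟨hC, Adjunction.has_limits_of_equivalence E, hC.toHasColimitsOfSize⟩

end

end SigmaRel

/-! ### Zeros and inverses in weak Σ-monoids. -/

/-- The empty family. -/
noncomputable def Family.nil (X : Type u) : Family X := Family.of (fun i : Empty => i.elim)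

/-- The family with two members. -/
noncomputable def Family.pair {X : Type u} (x y : X) : Family X := Family.of ![x, y]

@[simp]
theorem Family.map_nil {X : Type u} {Y : Type v} (f : X → Y) :
    Family.map f (Family.nil X) = Family.nil Y :=
  (Family.map_of f _).trans (congrArg Family.of (funext fun i : Empty => i.elim))

@[simp]
theorem Family.map_pair {X : Type u} {Y : Type v} (f : X → Y) (x y : X) :
    Family.map f (Family.pair x y) = Family.pair (f x) (f y) :=
  (Family.map_of f _).trans
    (congrArg Family.of (funext fun i : Fin 2 => by fin_cases i <;> rfl))

/-- Bracketing for families with fixed index types. -/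
def Bracketing {X : Type u} (S : Family X →. X) (J : Type) [Countable J] (I : J → Type)
    [∀ j, Countable (I j)] : Prop :=
  ∀ (x : ∀ j, I j → X) (y : J → X), (∀ j, y j ∈ S (Family.of (x j))) →
    ∀ a : X, a ∈ S (Family.of (fun p : Σ j, I j => x p.1 p.2)) → a ∈ S (Family.of y)

/-- Flattening for families with fixed index types. -/
def Flattening {X : Type u} (S : Family X →. X) (J : Type) [Countable J] (I : J → Type)
    [∀ j, Countable (I j)] : Prop :=
  ∀ (x : ∀ j, I j → X) (y : J → X), (∀ j, y j ∈ S (Family.of (x j))) →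
    ∀ a : X, a ∈ S (Family.of y) → a ∈ S (Family.of (fun p : Σ j, I j => x p.1 p.2))

namespace IsWeak

variable {X : Type u} {S : Family X →. X} (hS : IsWeak S)
include hS

/-- Zeros may be inserted: bracket the small family along the fibres of `φ`, which have at most one
element; an empty fibre contributes the sum `z`. -/
theorem mem_of_mem_comp {ι κ : Type} [Countable ι] [Countable κ] {φ : κ → ι}
    (hφ : Function.Injective φ) {z : X} (hz : z ∈ S (Family.nil X)) {y : ι → X}
    (hy : ∀ i, i ∉ Set.range φ → y i = z) {b : X} (hb : b ∈ S (Family.of (fun k => y (φ k)))) :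
    b ∈ S (Family.of y) := by
  have hsub (i : ι) : Subsingleton {k // φ k = i} :=
    ⟨fun k l => Subtype.ext (hφ (k.2.trans l.2.symm))⟩
  refine hS.bracketing (I := fun i => {k // φ k = i}) (fun _ k => y (φ k.1)) y (fun i => ?_) b ?_
  · by_cases h : i ∈ Set.range φ
    · obtain ⟨k, rfl⟩ := h
      convert hS.singleton (y (φ k)) using 2
      exact (Family.of_eq_of_iff _ _).2 ⟨⟨fun _ => (), fun _ => ⟨k, rfl⟩,
        fun _ => Subsingleton.elim _ _, fun _ => rfl⟩, fun l => congrArg y l.2⟩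
    · rw [hy i h]
      have : IsEmpty {k // φ k = i} := ⟨fun k => h ⟨k.1, k.2⟩⟩
      convert hz using 2
      exact (Family.of_eq_of_iff _ _).2 ⟨Equiv.equivOfIsEmpty _ _, fun l => isEmptyElim l⟩
  · convert hb using 2
    exact (Family.of_eq_of_iff _ _).2 ⟨Equiv.sigmaFiberEquiv φ, fun _ => rfl⟩

/-- Zeros may be removed, and not necessarily all of them, so no premise says that an entry is
nonzero. The nonzero subfamily has some sum `b`; inserting zeros carries `b` to both families,
whence `b = a`. -/
theorem mem_comp {ι κ : Type} [Countable ι] [Countable κ] {φ : κ → ι}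
    (hφ : Function.Injective φ) {z : X} (hz : z ∈ S (Family.nil X)) {y : ι → X}
    (hy : ∀ i, i ∉ Set.range φ → y i = z) {a : X} (ha : a ∈ S (Family.of y)) :
    a ∈ S (Family.of (fun k => y (φ k))) := by
  obtain ⟨z', hz', h⟩ := hS.neutral
  obtain rfl := Part.mem_unique hz hz'
  obtain ⟨b, hb⟩ := Part.dom_iff_mem.1 (h y (Part.dom_iff_mem.2 ⟨a, ha⟩))
  have hr (i : {i // y i ≠ z}) : ∃ k, φ k = i.1 := by
    by_contra h
    exact i.2 (hy _ h)
  choose ψ hψ using hr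
  have hψ' : Function.Injective ψ := fun i j hij =>
    Subtype.ext (by rw [← hψ i, ← hψ j, hij])
  have hb' : b ∈ S (Family.of (fun k => y (φ k))) := by
    refine hS.mem_of_mem_comp hψ' hz (fun k hk => ?_) (by simpa only [hψ] using hb)
    by_contra hne
    exact hk ⟨⟨φ k, hne⟩, hφ (hψ _)⟩
  rwa [Part.mem_unique ha (hS.mem_of_mem_comp hφ hz hy hb')]

/-- Flattening y' + (x + y) = y' + 0 gives the triple y', x, y the sum y'; symmetrically y, x, y'
has sum y. These are the same family up to reindexing. -/
theorem eq_of_mem_pair {x y y' z : X} (hz : z ∈ S (Family.nil X))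
    (h : z ∈ S (Family.pair x y)) (h' : z ∈ S (Family.pair x y')) : y = y' := by
  have add_zero (x : X) : x ∈ S (Family.of ![x, z]) := by
    refine hS.mem_of_mem_comp (φ := fun _ : Unit => (0 : Fin 2)) (fun _ _ _ => rfl) hz
      (fun i hi => ?_) (hS.singleton x)
    fin_cases i
    · exact (hi ⟨(), rfl⟩).elim
    · rfl
  let I (j : Bool) : Type := match j with
    | false => Unit
    | true => Fin 2
  have : ∀ j, Countable (I j)
    | false => inferInstanceAs (Countable Unit)
    | true => inferInstanceAs (Countable (Fin 2))
  let e : (Σ j, I j) ≃ Option (Fin 2) :=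
    { toFun := fun
        | ⟨false, _⟩ => none
        | ⟨true, i⟩ => some i
      invFun := fun
        | none => ⟨false, ()⟩
        | some i => ⟨true, i⟩
      left_inv := fun
        | ⟨false, _⟩ => rfl
        | ⟨true, _⟩ => rfl
      right_inv := fun
        | none => rfl
        | some _ => rfl }
  have flat (y y' : X) (h : z ∈ S (Family.pair x y)) :
      y' ∈ S (Family.of fun o : Option (Fin 2) => o.elim y' ![x, y]) := by
    have := hS.flattening (J := Bool) (I := I)
      (fun | false => fun _ => y' | true => ![x, y]) (fun | false => y' | true => z)
      (fun | false => hS.singleton y' | true => h) y' (by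
        convert add_zero y' using 2
        exact (Family.of_eq_of_iff _ _).2 ⟨finTwoEquiv.symm, by rintro (_ | _) <;> rfl⟩)
    convert this using 2
    exact ((Family.of_eq_of_iff _ _).2 ⟨e, by rintro ⟨_ | _, _⟩ <;> rfl⟩).symm
  refine Part.mem_unique (flat y' y h') ?_
  convert flat y y' h using 2
  refine (Family.of_eq_of_iff _ _).2 ⟨Equiv.swap none (some 1), ?_⟩
  rintro (_ | i)
  · simp
  · fin_cases i
    · simp [Equiv.swap_apply_of_ne_of_ne]
    · simp

end IsWeak

/-! ### The embedding of weak Σ-monoids. -/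

namespace SigmaRel

section Sat

variable {V : Type v} {X : SigmaRel.{u}} (f : V → X.carrier)

@[simp] theorem sat_empty : X.Sat f ∅ ↔ True := by simp [Sat]

@[simp] theorem sat_singleton (p : Family V × V) : X.Sat f {p} ↔ pairMap f p ∈ X.rel := by
  simp [Sat]

@[simp] theorem sat_insert (p : Family V × V) (Φ : Set (Family V × V)) :
    X.Sat f (insert p Φ) ↔ pairMap f p ∈ X.rel ∧ X.Sat f Φ := by
  simp [Sat]

@[simp] theorem sat_union (Φ Ψ : Set (Family V × V)) :
    X.Sat f (Φ ∪ Ψ) ↔ X.Sat f Φ ∧ X.Sat f Ψ := by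
  simp only [Sat, Set.mem_union, or_imp, forall_and]

@[simp] theorem sat_range {ι : Type w} (p : ι → Family V × V) :
    X.Sat f (Set.range p) ↔ ∀ i, pairMap f (p i) ∈ X.rel := by
  simp [Sat]

end Sat

/-- The relation of a weak `Σ`-monoid. -/
def ofWeak : WeakSigmaMon.{u} ⥤ SigmaRel.{u} where
  obj X := ⟨X.carrier, {p | p.2 ∈ X.sum p.1}⟩
  map f := ⟨f.toFun, fun p hp => f.isSigmaHom p.1 p.2 hp⟩

instance : ofWeak.{u}.Full where
  map_surjective f := ⟨⟨f.toFun, fun F a h => f.map_rel (F, a) h⟩, rfl⟩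

instance : ofWeak.{u}.Faithful where
  map_injective h := WeakSigmaMon.Hom.ext (congrArg Hom.toFun h)

/-- The partial function underlying a functional relation. -/
noncomputable def sum (X : SigmaRel.{u}) : Family X.carrier →. X.carrier :=
  fun F => ⟨∃ a, (F, a) ∈ X.rel, fun h => h.choose⟩

/-! ### Local objects satisfy the axioms. -/

section

variable {C : Type v} [Category.{w} C] {G : C ⥤ WeakSigmaMon.{u}} {X : SigmaRel.{u}}
  (hX : (orthogonalMorphisms (G ⋙ ofWeak)).isLocal X)

include hX

/-- Unique existence statements for a single additional variable. -/
theorem existsUnique_elim_of_isLocal {V : Type} [Countable V] {Φ : Set (Family V × V)}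
    {Ψ : Set (Family (Option V) × Option V)} (hΦ : Φ.Countable) (hΨ : Ψ.Countable)
    (h : ∀ (c : C) (v : V → (ofWeak.obj (G.obj c)).carrier), (ofWeak.obj (G.obj c)).Sat v Φ →
      ∃! a, (ofWeak.obj (G.obj c)).Sat (fun o : Option V => o.elim a v) Ψ)
    (v : V → X.carrier) (hv : X.Sat v Φ) :
    ∃! a, X.Sat (fun o : Option V => o.elim a v) Ψ := by
  have aux {Y : SigmaRel.{u}} (v : V → Y.carrier) :
      (∃! a, Y.Sat (fun o : Option V => o.elim a v) Ψ) ↔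
        ∃! w : Option V → Y.carrier, w ∘ some = v ∧ Y.Sat w Ψ := by
    have he (w : Option V → Y.carrier) : (fun o => Option.elim o (w none) (w ∘ some)) = w :=
      funext fun o => by cases o <;> rfl
    constructor
    · rintro ⟨a, ha, hu⟩
      refine ⟨fun o => o.elim a v, ⟨rfl, ha⟩, ?_⟩
      rintro w ⟨rfl, hw⟩
      rw [← hu (w none) (by beta_reduce; rwa [he]), he]
    · rintro ⟨w, ⟨rfl, hw⟩, hu⟩
      refine ⟨w none, by beta_reduce; rwa [he], fun a ha => ?_⟩
      exact congrFun (hu (fun o => o.elim a (w ∘ some)) ⟨rfl, ha⟩) none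
  rw [aux]
  exact existsUnique_of_isLocal hX some hΦ hΨ (fun c v hv => (aux v).1 (h c v hv)) v hv

/-- Single-valuedness is orthogonality to a map that merges the two value variables and adds no
atoms. -/
theorem eq_of_mem_rel_of_isLocal {F : Family X.carrier} {a b : X.carrier} (ha : (F, a) ∈ X.rel)
    (hb : (F, b) ∈ X.rel) : a = b := by
  obtain ⟨I, x, rfl⟩ := Family.exists_eq_of F
  obtain ⟨w, ⟨hw, -⟩, -⟩ := existsUnique_of_isLocal hX
    (V := I ⊕ Bool) (V' := I ⊕ Unit) (Φ := {(Family.of Sum.inl, Sum.inr true),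
      (Family.of Sum.inl, Sum.inr false)}) (Sum.map id fun _ => ()) (Ψ := ∅)
    (Set.to_countable _) (Set.to_countable _) (fun c v hv => by
      simp only [sat_insert, sat_singleton, pairMap_mk, Family.map_of] at hv
      refine ⟨Sum.elim (fun i => v (Sum.inl i)) (fun _ => v (Sum.inr true)), ⟨?_, by simp⟩, ?_⟩
      · ext (i | i | i)
        · rfl
        · exact Part.mem_unique hv.1 hv.2
        · rfl
      · rintro w ⟨rfl, -⟩
        ext (i | i) <;> rfl)
    (Sum.elim x fun i => if i then a else b) (by
      simp only [sat_insert, sat_singleton, pairMap_mk, Family.map_of]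
      exact ⟨ha, hb⟩)
  exact (congrFun hw (Sum.inr true)).symm.trans (congrFun hw (Sum.inr false))

theorem mem_sum_iff {F : Family X.carrier} {a : X.carrier} :
    a ∈ X.sum F ↔ (F, a) ∈ X.rel :=
  ⟨fun ⟨h, ha⟩ => ha ▸ h.choose_spec,
    fun h => ⟨⟨a, h⟩, eq_of_mem_rel_of_isLocal hX 
      (Exists.choose_spec (p := fun b => (F, b) ∈ X.rel) ⟨a, h⟩) h⟩⟩

theorem bracketing_of_isLocal {J : Type} [Countable J] {I : J → Type} [∀ j, Countable (I j)]
    (h : ∀ c, Bracketing (G.obj c).sum J I) : Bracketing X.sum J I := by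
  intro x y hy a ha
  rw [mem_sum_iff hX] at ha ⊢
  simp only [mem_sum_iff hX] at hy
  exact horn_of_isLocal hX (V := (Σ j, I j) ⊕ J ⊕ Unit)
    (Φ := {(Family.of Sum.inl, Sum.inr (Sum.inr ()))} ∪
      Set.range fun j => (Family.of fun i : I j => Sum.inl ⟨j, i⟩, Sum.inr (Sum.inl j)))
    (Family.of fun j => Sum.inr (Sum.inl j), Sum.inr (Sum.inr ()))
    ((Set.countable_singleton _).union (Set.countable_range _))
    (fun c v hv => by
      simp only [sat_union, sat_range, sat_singleton, pairMap_mk, Family.map_of] at hv ⊢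
      exact h c (fun j i => v (Sum.inl ⟨j, i⟩)) _ hv.2 _ hv.1)
    (Sum.elim (fun p => x p.1 p.2) (Sum.elim y fun _ => a)) (by
      simp only [sat_union, sat_range, sat_singleton, pairMap_mk, Family.map_of]
      exact ⟨ha, hy⟩)

theorem flattening_of_isLocal {J : Type} [Countable J] {I : J → Type} [∀ j, Countable (I j)]
    (h : ∀ c, Flattening (G.obj c).sum J I) : Flattening X.sum J I := by
  intro x y hy a ha
  rw [mem_sum_iff hX] at ha ⊢
  simp only [mem_sum_iff hX] at hy
  exact horn_of_isLocal hX (V := (Σ j, I j) ⊕ J ⊕ Unit)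
    (Φ := {(Family.of fun j => Sum.inr (Sum.inl j), Sum.inr (Sum.inr ()))} ∪
      Set.range fun j => (Family.of fun i : I j => Sum.inl ⟨j, i⟩, Sum.inr (Sum.inl j)))
    (Family.of Sum.inl, Sum.inr (Sum.inr ()))
    ((Set.countable_singleton _).union (Set.countable_range _))
    (fun c v hv => by
      simp only [sat_union, sat_range, sat_singleton, pairMap_mk, Family.map_of] at hv ⊢
      exact h c (fun j i => v (Sum.inl ⟨j, i⟩)) _ hv.2 _ hv.1)
    (Sum.elim (fun p => x p.1 p.2) (Sum.elim y fun _ => a)) (by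
      simp only [sat_union, sat_range, sat_singleton, pairMap_mk, Family.map_of]
      exact ⟨ha, hy⟩)

theorem exists_zero_of_isLocal : ∃ z, z ∈ X.sum (Family.nil X.carrier) := by
  simp only [mem_sum_iff hX]
  obtain ⟨z, hz, -⟩ := existsUnique_elim_of_isLocal hX (V := Empty) (Φ := ∅)
    (Ψ := {(Family.nil _, none)}) (Set.to_countable _) (Set.to_countable _) (fun c v _ => by
      obtain ⟨z, hz, -⟩ := (G.obj c).isWeak.neutral
      simp only [sat_singleton, pairMap_mk, Family.map_nil]
      exact ⟨z, hz, fun z' hz' => Part.mem_unique hz' hz⟩) Empty.elim (by simp)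
  simp only [sat_singleton, pairMap_mk, Family.map_nil] at hz
  exact ⟨z, hz⟩

theorem isWeak_of_isLocal : IsWeak X.sum where
  singleton x := by
    rw [mem_sum_iff hX]
    exact horn_of_isLocal hX (V := Unit) (Φ := ∅) (Family.of id, ()) (Set.to_countable _)
      (fun c v _ => (G.obj c).isWeak.singleton (v ())) (fun _ => x) (by simp)
  neutral := by
    classical
    obtain ⟨z, hz⟩ := exists_zero_of_isLocal hX
    refine ⟨z, hz, fun {ι} _ x hx => ?_⟩
    obtain ⟨a, ha⟩ := Part.dom_iff_mem.1 hx
    refine Part.dom_iff_mem.2 ⟨a, ?_⟩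
    rw [mem_sum_iff hX] at ha hz ⊢
    -- Which entries vanish is decided in `X` before the Horn clause is formed: those indices share
    -- the variable `Sum.inr false`, which a premise forces to be zero. `Sum.inr true` is the sum.
    let y : ι → {i // x i ≠ z} ⊕ Bool := fun i =>
      if h : x i ≠ z then Sum.inl ⟨i, h⟩ else Sum.inr false
    exact horn_of_isLocal hX (V := {i // x i ≠ z} ⊕ Bool)
      (Φ := {(Family.of y, Sum.inr true), (Family.nil _, Sum.inr false)})
      (Family.of Sum.inl, Sum.inr true) (Set.to_countable _)
      (fun c v hv => by
        simp only [sat_insert, sat_singleton, pairMap_mk, Family.map_of, Family.map_nil]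
          at hv ⊢
        have := (G.obj c).isWeak.mem_comp (φ := fun i : {i // x i ≠ z} => i.1)
          Subtype.val_injective hv.2 (y := fun i => v (y i)) (fun i hi => by
            have : ¬ x i ≠ z := fun h => hi ⟨⟨i, h⟩, rfl⟩
            simp only [y, dif_neg this]; rfl) hv.1
        have hy (i : {i // x i ≠ z}) : y i.1 = Sum.inl i := dif_pos i.2
        simp only [hy] at this
        exact this)
      (Sum.elim (fun i => x i) fun b => if b then a else z) (by
        have hy : (fun i => Sum.elim (fun i => x i.1) (fun b => if b then a else z) (y i)) = x := by
          ext i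
          by_cases h : x i = z <;> simp [y, h]
        simp only [sat_insert, sat_singleton, pairMap_mk, Family.map_of, Family.map_nil, hy]
        exact ⟨ha, hz⟩)
  bracketing {_ _ _ _} :=
    bracketing_of_isLocal hX fun c => (G.obj c).isWeak.bracketing
  flattening {_ _ _ _} :=
    flattening_of_isLocal hX fun c => (G.obj c).isWeak.flattening

/-- Summability of a subfamily is an existence statement, unique because sums are single-valued. -/
theorem isStrong_of_isLocal (h : ∀ c, IsStrong (G.obj c).sum) : IsStrong X.sum where
  subsummability {ι κ _ _} x φ hφ hx := by
    obtain ⟨a, ha⟩ := Part.dom_iff_mem.1 hx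
    rw [mem_sum_iff hX] at ha
    simp only [Part.dom_iff_mem, mem_sum_iff hX]
    obtain ⟨b, hb, -⟩ := existsUnique_elim_of_isLocal hX (V := ι ⊕ Unit)
      (Φ := {(Family.of Sum.inl, Sum.inr ())})
      (Ψ := {(Family.of (fun k => some (Sum.inl (φ k))), none)})
      (Set.to_countable _) (Set.to_countable _) (fun c v hv => by
        simp only [sat_singleton, pairMap_mk, Family.map_of] at hv ⊢
        obtain ⟨b, hb⟩ := Part.dom_iff_mem.1
          ((h c).subsummability (fun i => v (Sum.inl i)) φ hφ
            (Part.dom_iff_mem.2 ⟨v (Sum.inr ()), hv⟩))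
        exact ⟨b, hb, fun b' hb' => Part.mem_unique hb' hb⟩)
      (Sum.elim x fun _ => a) (by
        simp only [sat_singleton, pairMap_mk, Family.map_of]
        exact ha)
    simp only [sat_singleton, pairMap_mk, Family.map_of] at hb
    exact ⟨b, hb⟩
  strong_bracketing {_ _ _ _} := bracketing_of_isLocal hX fun c => (h c).strong_bracketing
  strong_flattening {_ _ _ _} := flattening_of_isLocal hX fun c => (h c).strong_flattening

theorem isFinitelyTotal_of_isLocal (h : ∀ c, IsFinitelyTotal (G.obj c).sum) :
    IsFinitelyTotal X.sum := by
  intro ι _ x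
  simp only [Part.dom_iff_mem, mem_sum_iff hX]
  obtain ⟨a, ha, -⟩ := existsUnique_elim_of_isLocal hX (V := ι) (Φ := ∅)
    (Ψ := {(Family.of some, none)}) (Set.to_countable _) (Set.to_countable _) (fun c v _ => by
      simp only [sat_singleton, pairMap_mk, Family.map_of]
      obtain ⟨b, hb⟩ := Part.dom_iff_mem.1 (h c v)
      exact ⟨b, hb, fun b' hb' => Part.mem_unique hb' hb⟩) x (by simp)
  simp only [sat_singleton, pairMap_mk, Family.map_of] at ha
  exact ⟨a, ha⟩

/-- The inverse of x is the unique y with x + y = 0, so its existence transfers. Preservation of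
sums by inversion is then a Horn clause about pairs summing to zero. -/
theorem hasSigmaInverses_of_isLocal (h : ∀ c, HasSigmaInverses (G.obj c).sum) :
    HasSigmaInverses X.sum := by
  obtain ⟨z, hz⟩ := exists_zero_of_isLocal hX
  have hz' := (mem_sum_iff hX).1 hz
  have hneg (x : X.carrier) : ∃ y, z ∈ X.sum (Family.pair x y) := by
    simp only [mem_sum_iff hX]
    obtain ⟨y, hy, -⟩ := existsUnique_elim_of_isLocal hX (V := Bool)
      (Φ := {(Family.nil _, true)}) (Ψ := {(Family.pair (some false) none, some true)})
      (Set.to_countable _) (Set.to_countable _) (fun c v hv => by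
        simp only [sat_singleton, pairMap_mk, Family.map_nil, Family.map_pair] at hv ⊢
        obtain ⟨neg, hneg, -⟩ := h c
        obtain ⟨z', h₁, h₂⟩ := hneg (v false)
        obtain rfl : z' = v true := Part.mem_unique h₁ hv
        exact ⟨neg (v false), h₂, fun y hy => (G.obj c).isWeak.eq_of_mem_pair h₁ hy h₂⟩)
      (fun b => if b then z else x) (by
        simp only [sat_singleton, pairMap_mk, Family.map_nil]
        exact hz')
    simp only [sat_singleton, pairMap_mk, Family.map_pair] at hy
    exact ⟨y, hy⟩
  choose neg hneg using hneg
  refine ⟨neg, fun x => ⟨z, hz, hneg x⟩, fun F a ha => ?_⟩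
  obtain ⟨I, x, rfl⟩ := Family.exists_eq_of F
  simp only [mem_sum_iff hX] at ha hneg ⊢
  -- `(true, some i)` is an entry and `(true, none)` the sum; `false` marks their inverses, and
  -- `Sum.inr ()` is zero.
  exact horn_of_isLocal hX (V := Bool × Option I ⊕ Unit)
    (Φ := {(Family.of fun i => Sum.inl (true, some i), Sum.inl (true, none)),
        (Family.nil _, Sum.inr ())} ∪
      Set.range fun o => (Family.pair (Sum.inl (true, o)) (Sum.inl (false, o)), Sum.inr ()))
    (Family.of fun i => Sum.inl (false, some i), Sum.inl (false, none))
    ((Set.to_countable _).union (Set.countable_range _))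
    (fun c v hv => by
      simp only [sat_union, sat_insert, sat_range, sat_singleton, pairMap_mk, Family.map_of,
        Family.map_nil, Family.map_pair] at hv ⊢
      obtain ⟨⟨h₁, h₂⟩, h₃⟩ := hv
      obtain ⟨neg, hneg, hhom⟩ := h c
      have key (o : Option I) : v (Sum.inl (false, o)) = neg (v (Sum.inl (true, o))) := by
        obtain ⟨z', h₄, h₅⟩ := hneg (v (Sum.inl (true, o)))
        obtain rfl : z' = v (Sum.inr ()) := Part.mem_unique h₄ h₂
        exact (G.obj c).isWeak.eq_of_mem_pair h₂ (h₃ o) h₅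
      simp only [key]
      exact hhom _ _ h₁)
    (Sum.elim (fun p => p.2.elim (if p.1 then a else neg a)
      fun i => if p.1 then x i else neg (x i)) fun _ => z) (by
      simp only [sat_union, sat_insert, sat_range, sat_singleton, pairMap_mk, Family.map_of,
        Family.map_nil, Family.map_pair]
      refine ⟨⟨ha, hz'⟩, fun o => ?_⟩
      cases o with
      | none => exact hneg a
      | some i => exact hneg (x i))

/-- The weak `Σ`-monoid underlying a local object. -/
noncomputable def toWeak : WeakSigmaMon.{u} where
  carrier := X.carrier
  sum := X.sum
  isWeak := isWeak_of_isLocal hX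

theorem ofWeak_obj_toWeak : ofWeak.obj (toWeak hX) = X := by
  obtain ⟨A, R⟩ := X
  exact congrArg (SigmaRel.mk A) (Set.ext fun _ => mem_sum_iff hX)

end

/-! ### Local presentability of the four categories. -/

theorem locallyPresentable_fullSubcategory (P : ObjectProperty WeakSigmaMon.{u})
    (hP : ∀ X (hX : (orthogonalMorphisms (P.ι ⋙ ofWeak)).isLocal X), P (toWeak hX)) :
    IsCardinalLocallyPresentable.{u} P.FullSubcategory (Cardinal.aleph.{u} 1) ∧
      HasLimitsOfSize.{u, u} P.FullSubcategory ∧ HasColimitsOfSize.{u, u} P.FullSubcategory :=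
  locallyPresentable_of_isLocal_le (P.ι ⋙ ofWeak) fun X hX =>
    ⟨⟨toWeak hX, hP X hX⟩, ⟨eqToIso (ofWeak_obj_toWeak hX)⟩⟩

theorem locallyPresentable_weakSigmaMon :
    IsCardinalLocallyPresentable.{u} WeakSigmaMon.{u} (Cardinal.aleph.{u} 1) ∧
      HasLimitsOfSize.{u, u} WeakSigmaMon.{u} ∧ HasColimitsOfSize.{u, u} WeakSigmaMon.{u} :=
  -- The identity functor puts the embedding in the form `G ⋙ ofWeak` required by `toWeak`.
  locallyPresentable_of_isLocal_le (𝟭 _ ⋙ ofWeak) fun _ hX =>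
    ⟨toWeak hX, ⟨eqToIso (ofWeak_obj_toWeak hX)⟩⟩

end SigmaRel
end SigmaMonoids

theorem mainTheorem7 :
    (IsCardinalLocallyPresentable.{u} SigmaMonoids.WeakSigmaMon.{u} (Cardinal.aleph.{u} 1) ∧
      HasLimitsOfSize.{u, u} SigmaMonoids.WeakSigmaMon.{u} ∧
      HasColimitsOfSize.{u, u} SigmaMonoids.WeakSigmaMon.{u}) ∧
    (IsCardinalLocallyPresentable.{u} SigmaMonoids.StrongSigmaMon.{u} (Cardinal.aleph.{u} 1) ∧
      HasLimitsOfSize.{u, u} SigmaMonoids.StrongSigmaMon.{u} ∧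
      HasColimitsOfSize.{u, u} SigmaMonoids.StrongSigmaMon.{u}) ∧
    (IsCardinalLocallyPresentable.{u} SigmaMonoids.FinTotalSigmaMon.{u} (Cardinal.aleph.{u} 1) ∧
      HasLimitsOfSize.{u, u} SigmaMonoids.FinTotalSigmaMon.{u} ∧
      HasColimitsOfSize.{u, u} SigmaMonoids.FinTotalSigmaMon.{u}) ∧
    (IsCardinalLocallyPresentable.{u} SigmaMonoids.SigmaGrp.{u} (Cardinal.aleph.{u} 1) ∧
      HasLimitsOfSize.{u, u} SigmaMonoids.SigmaGrp.{u} ∧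
      HasColimitsOfSize.{u, u} SigmaMonoids.SigmaGrp.{u}) := by
  open SigmaMonoids.SigmaRel in
  exact ⟨locallyPresentable_weakSigmaMon,
    locallyPresentable_fullSubcategory _ fun _ hX => isStrong_of_isLocal hX fun c => c.property,
    locallyPresentable_fullSubcategory _ fun _ hX =>
      isFinitelyTotal_of_isLocal hX fun c => c.property,
    locallyPresentable_fullSubcategory _ fun _ hX =>
      ⟨isFinitelyTotal_of_isLocal hX fun c => c.property.1,
        hasSigmaInverses_of_isLocal hX fun c => c.property.2⟩⟩
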